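/- There is an integer $k_0$ such that the following holds for all integers $k\ge k_0$ and all integers $n\ge\left(2+\frac{3}{\ln k}\right)k^2$. Let $G$ be a (simple) graph on the vertex set $[n]=\{1,\dots,n\}$ with at most $nk$ edges, and let $\mathcal I(G)$ be the family of all $k$-element subsets of $[n]$ that are independent in $G$. Let $\mathcal F\subset\mathcal I(G)$, and suppose that for some integer $0\le t\le k$ there is a family $\mathcal G$ of $t$-element subsets of $[n]$ such that $F\cap B\neq\varnothing$ for all $F\in\mathcal F$ and $B\in\mathcal G$, and such that $\tau(\mathcal G)\ge\sqrt k$. Here the cover number $\tau(\mathcal G)$ is the smallest size of a set $C\subset[n]$ that meets every member of $\mathcal G$ (and $\tau(\mathcal G)=\infty$ if there is no such set, i.e. if $\varnothing\in\mathcal G$). Then $$|\mathcal I(G)|>n\cdot|\mathcal F|.$$ -/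

import Mathlib

open scoped ENNReal

namespace KneserFamily

/-- Two families of subsets of `α` are cross-intersecting if every member of the first one
meets every member of the second one. -/
def CrossIntersecting {α : Type*} [DecidableEq α] (𝒜 ℬ : Finset (Finset α)) : Prop :=
  ∀ A ∈ 𝒜, ∀ B ∈ ℬ, (A ∩ B).Nonempty

/-- `C` is a cover of the family `𝒢` if it meets every member of `𝒢`. -/
def IsCover {α : Type*} [DecidableEq α] (𝒢 : Finset (Finset α)) (C : Finset α) : Prop :=
  ∀ A ∈ 𝒢, (C ∩ A).Nonempty

/-- The cover number `τ(𝒢)`: the smallest size of a cover of `𝒢`.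
It is `⊤` exactly when there is no cover, that is, when `∅ ∈ 𝒢`. -/
noncomputable def coverNumber {α : Type*} [DecidableEq α] (𝒢 : Finset (Finset α)) : ℕ∞ :=
  ⨅ (C : Finset α) (_ : IsCover 𝒢 C), (C.card : ℕ∞)

end KneserFamily

/-! Write `L = log k`, let `N` be the number of independent `k`-sets, and let `s = ⌈√k⌉`. A set `X`
with fewer than `s` elements does not cover `𝓖`, so some `B ∈ 𝓖` is disjoint from `X`, and every `F
∈ 𝓕` meets `B`. Hence one can branch `s` times, adding an element of such a `B` to `X` each time.

If `n ≥ 8k²`, counting all branches suffices (`mul_card_lt_of_large`): there are at most `k ^ s`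
leaves, and prescribing `s` elements costs a factor at most `(2k/n) ^ s`.

If `n ≤ 8k²`, the members of `𝓕` are sorted by their least element in `B`, which makes the branches
disjoint (`card_traceFam_le_of_dichotomy`). All branches together omit the independent sets that
avoid `B`. By `traceFam_dichotomy` these form a proportion of at least `k^(-2/5)/2`, unless the
whole branch is negligible. Since `s · k^(-2/5)` is about `k^(1/10)`, which is far more than `log
n`, the surviving proportion after `s` steps is below `1/n`.

The dichotomy rests on the Moon–Moser inequality for numbers of independent sets. In the whole graph
it carries the edge bound upwards to lower bounds on the average number of extensions
(`indepCount_succ_ge`). In a subset `W` it carries a deficiency at one level down to all smaller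
levels (`indepCount_succ_le`), where the losses multiply to an exponentially small factor
(`indepCount_le_mul_exp`). So either the consecutive counts in `W \ B` are well behaved and deleting
`B` costs only a factor of about `k^(2/5)`, or `W` carries almost nothing (`indepCount_dichotomy`).
-/

/-! ### Extensions of independent sets and the Moon–Moser inequality. -/

/-- The independent sets of size `m` contained in `W`. -/
noncomputable def indepFam {V : Type*} (G : SimpleGraph V) (W : Finset V) (m : ℕ) :
    Finset (Finset V) := by
  classical exact {A ∈ W.powersetCard m | G.IsIndepSet (A : Set V)}

/-- The number of independent sets of size `m` contained in `W`. -/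
noncomputable def indepCount {V : Type*} (G : SimpleGraph V) (W : Finset V) (m : ℕ) : ℕ :=
  (indepFam G W m).card

/-- The vertices of `W` that extend `A` to a larger independent set. -/
noncomputable def extVerts {V : Type*} [DecidableEq V] (G : SimpleGraph V) (W A : Finset V) :
    Finset V := by
  classical exact {v ∈ W | v ∉ A ∧ G.IsIndepSet ((insert v A : Finset V) : Set V)}

theorem mem_indepFam {V : Type*} {G : SimpleGraph V} {W A : Finset V} {m : ℕ} :
    A ∈ indepFam G W m ↔ A ⊆ W ∧ A.card = m ∧ G.IsIndepSet (A : Set V) := by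
  classical
  simp [indepFam, Finset.mem_powersetCard, and_assoc]

theorem mem_extVerts {V : Type*} [DecidableEq V] {G : SimpleGraph V} {W A : Finset V} {v : V} :
    v ∈ extVerts G W A ↔
      v ∈ W ∧ v ∉ A ∧ G.IsIndepSet ((insert v A : Finset V) : Set V) := by
  classical
  simp [extVerts]

theorem isIndepSet_mono {V : Type*} {G : SimpleGraph V} {A B : Set V} (h : A ⊆ B)
    (hB : G.IsIndepSet B) : G.IsIndepSet A :=
  Set.Pairwise.mono h hB

/-- Double counting through the bijection `(A, a) ↔ (A.erase a, a)`. With `g = 1` it counts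
extensions; with `g` the extension number it gives their sum of squares. -/
theorem sum_indepFam_erase {V : Type*} [DecidableEq V] (G : SimpleGraph V) (W : Finset V) (p : ℕ)
    (g : Finset V → ℕ) :
    ∑ A ∈ indepFam G W (p + 1), ∑ a ∈ A, g (A.erase a) =
      ∑ C ∈ indepFam G W p, (extVerts G W C).card * g C := by
  have h : ∀ C ∈ indepFam G W p,
      (extVerts G W C).card * g C = ∑ _v ∈ extVerts G W C, g C := by
    intro C _
    simp
  rw [Finset.sum_congr rfl h, Finset.sum_sigma', Finset.sum_sigma']
  refine Finset.sum_bij' (fun x _ => ⟨x.1.erase x.2, x.2⟩) (fun x _ => ⟨insert x.2 x.1, x.2⟩)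
    ?_ ?_ ?_ ?_ ?_
  · rintro ⟨A, a⟩ h
    simp only [Finset.mem_sigma, mem_indepFam, mem_extVerts] at h ⊢
    obtain ⟨⟨h1, h2, h3⟩, h4⟩ := h
    refine ⟨⟨(Finset.erase_subset _ _).trans h1, by rw [Finset.card_erase_of_mem h4, h2]; rfl,
      isIndepSet_mono (Finset.coe_subset.2 (Finset.erase_subset _ _)) h3⟩, h1 h4, by simp, ?_⟩
    rwa [Finset.insert_erase h4]
  · rintro ⟨C, v⟩ h
    simp only [Finset.mem_sigma, mem_indepFam, mem_extVerts] at h ⊢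
    obtain ⟨⟨h1, h2, h3⟩, h4, h5, h6⟩ := h
    exact ⟨⟨Finset.insert_subset h4 h1, by rw [Finset.card_insert_of_notMem h5, h2], h6⟩,
      Finset.mem_insert_self _ _⟩
  · rintro ⟨A, a⟩ h
    simp only [Finset.mem_sigma] at h
    simp [Finset.insert_erase h.2]
  · rintro ⟨C, v⟩ h
    simp only [Finset.mem_sigma, mem_extVerts] at h
    simp [Finset.erase_insert h.2.2.1]
  · rintro ⟨A, a⟩ h
    rfl

theorem sum_card_extVerts {V : Type*} [DecidableEq V] (G : SimpleGraph V) (W : Finset V) (p : ℕ) :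
    ∑ C ∈ indepFam G W p, (extVerts G W C).card = (p + 1) * indepCount G W (p + 1) := by
  have h := sum_indepFam_erase G W p (fun _ => 1)
  simp only [mul_one, Finset.sum_const, smul_eq_mul] at h
  rw [← h, Finset.sum_congr rfl (fun A hA => (mem_indepFam.1 hA).2.1)]
  simp [indepCount, mul_comm]

/-- Count by the vertex `v`. If `v` extends `A`, it contributes at most `p + 1`. Otherwise it
contributes at most 1: a vertex of `A` can extend only the set from which it was erased, and a
vertex outside `A` that extends both `A.erase a` and `A.erase b` with `a ≠ b` has no neighbour in
`A`. -/
theorem sum_card_extVerts_erase_le {V : Type*} [DecidableEq V] (G : SimpleGraph V)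
    {W A : Finset V} {p : ℕ} (hA : A ∈ indepFam G W (p + 1)) :
    ∑ a ∈ A, (extVerts G W (A.erase a)).card ≤ W.card + p * (extVerts G W A).card := by
  classical
  obtain ⟨h1, h2, h3⟩ := mem_indepFam.1 hA
  have e1 : ∑ a ∈ A, (extVerts G W (A.erase a)).card =
      ∑ v ∈ W, ({a ∈ A | v ∈ extVerts G W (A.erase a)} : Finset V).card := by
    have : ∀ a ∈ A, (extVerts G W (A.erase a)).card =
        ({v ∈ W | v ∈ extVerts G W (A.erase a)} : Finset V).card := by
      intro a _
      congr 1
      ext v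
      simp only [Finset.mem_filter, mem_extVerts]
      tauto
    rw [Finset.sum_congr rfl this]
    exact Finset.sum_card_bipartiteAbove_eq_sum_card_bipartiteBelow
      (fun a v => v ∈ extVerts G W (A.erase a))
  have e2 : W.card + p * (extVerts G W A).card =
      ∑ v ∈ W, (1 + p * if v ∈ extVerts G W A then 1 else 0) := by
    rw [Finset.sum_add_distrib, ← Finset.mul_sum, Finset.sum_boole]
    simp only [Finset.sum_const, smul_eq_mul, mul_one, Nat.cast_id]
    congr 3
    ext v
    simp only [Finset.mem_filter, mem_extVerts]
    tauto
  rw [e1, e2]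
  refine Finset.sum_le_sum fun v hv => ?_
  by_cases hE : v ∈ extVerts G W A
  · rw [if_pos hE, mul_one, add_comm, ← h2]
    exact Finset.card_filter_le _ _
  · rw [if_neg hE, mul_zero, add_zero, Finset.card_le_one]
    intro a ha b hb
    simp only [Finset.mem_filter, mem_extVerts, Finset.mem_erase, not_and] at ha hb
    obtain ⟨ha, _, ha1, ha2⟩ := ha
    obtain ⟨hb, _, hb1, hb2⟩ := hb
    by_contra hab
    by_cases hvA : v ∈ A
    · have hva : v = a := by
        by_contra h
        exact ha1 h hvA
      have hvb : v = b := by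
        by_contra h
        exact hb1 h hvA
      exact hab (hva.symm.trans hvb)
    · refine hE (mem_extVerts.2 ⟨hv, hvA, ?_⟩)
      have key : ∀ x ∈ A, ¬ G.Adj v x := by
        intro x hx
        have hvx : v ≠ x := fun h => hvA (h ▸ hx)
        by_cases hxa : x = a
        · exact hb2 (by simp) (by simp [hx, hxa ▸ hab]) hvx
        · exact ha2 (by simp) (by simp [hx, hxa]) hvx
      intro x hx y hy hxy
      simp only [Finset.coe_insert, Set.mem_insert_iff, Finset.mem_coe] at hx hy
      rcases hx with rfl | hx <;> rcases hy with rfl | hy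
      · exact absurd rfl hxy
      · exact key _ hy
      · exact fun h => key _ hx h.symm
      · exact h3 hx hy hxy

/-- The Moon–Moser inequality for independent sets. -/
theorem moon_moser {V : Type*} (G : SimpleGraph V) (W : Finset V) (p : ℕ) :
    ((p + 1) * indepCount G W (p + 1)) ^ 2 ≤
      indepCount G W p *
        (W.card * indepCount G W (p + 1) + p * (p + 2) * indepCount G W (p + 2)) := by
  classical
  rw [← sum_card_extVerts]
  -- Cauchy–Schwarz for the extension numbers of the independent `p`-sets.
  refine (sq_sum_le_card_mul_sum_sq).trans (Nat.mul_le_mul le_rfl ?_)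
  have h := sum_indepFam_erase G W p (fun C => (extVerts G W C).card)
  simp only [sq]
  rw [← h]
  refine (Finset.sum_le_sum fun A hA => sum_card_extVerts_erase_le G hA).trans ?_
  rw [Finset.sum_add_distrib, ← Finset.mul_sum, sum_card_extVerts]
  simp only [Finset.sum_const, smul_eq_mul, indepCount]
  apply le_of_eq
  ring

theorem indepCount_zero {V : Type*} (G : SimpleGraph V) (W : Finset V) :
    indepCount G W 0 = 1 := by
  rw [indepCount, Finset.card_eq_one]
  refine ⟨∅, ?_⟩
  ext A
  rw [mem_indepFam, Finset.mem_singleton]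
  constructor
  · exact fun h => Finset.card_eq_zero.1 h.2.1
  · rintro rfl
    simp [SimpleGraph.IsIndepSet]

theorem indepFam_one {V : Type*} (G : SimpleGraph V) (W : Finset V) :
    indepFam G W 1 = W.map ⟨singleton, Finset.singleton_injective⟩ := by
  ext A
  simp only [mem_indepFam, Finset.mem_map, Function.Embedding.coeFn_mk, Finset.card_eq_one]
  constructor
  · rintro ⟨h1, ⟨a, rfl⟩, -⟩
    exact ⟨a, h1 (by simp), rfl⟩
  · rintro ⟨a, ha, rfl⟩
    simp [ha, SimpleGraph.IsIndepSet]

theorem indepCount_one {V : Type*} (G : SimpleGraph V) (W : Finset V) :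
    indepCount G W 1 = W.card := by
  simp [indepCount, indepFam_one]

theorem indepCount_mono {V : Type*} (G : SimpleGraph V) {W W' : Finset V} (h : W ⊆ W') (m : ℕ) :
    indepCount G W m ≤ indepCount G W' m := by
  refine Finset.card_le_card fun A hA => ?_
  rw [mem_indepFam] at hA ⊢
  exact ⟨hA.1.trans h, hA.2⟩

theorem succ_mul_indepCount_le {V : Type*} (G : SimpleGraph V) (W : Finset V) (m : ℕ) :
    (m + 1) * indepCount G W (m + 1) ≤ W.card * indepCount G W m := by
  classical
  rw [← sum_card_extVerts]
  refine (Finset.sum_le_card_nsmul _ _ W.card fun A _ => Finset.card_le_card ?_).trans ?_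
  · exact fun v hv => (mem_extVerts.1 hv).1
  · rw [smul_eq_mul, mul_comm, indepCount]

theorem indepCount_pos_of_le {V : Type*} {G : SimpleGraph V} {W : Finset V} {a b : ℕ}
    (hab : a ≤ b) (h : 0 < indepCount G W b) : 0 < indepCount G W a := by
  obtain ⟨A, hA⟩ := Finset.card_pos.1 h
  obtain ⟨h1, h2, h3⟩ := mem_indepFam.1 hA
  obtain ⟨C, hC, hc⟩ := Finset.exists_subset_card_eq (h2 ▸ hab)
  exact Finset.card_pos.2 ⟨C, mem_indepFam.2
    ⟨hC.trans h1, hc, isIndepSet_mono (Finset.coe_subset.2 hC) h3⟩⟩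

/-- The only place where edges are counted: a vertex `v` has at least `n - 1 - deg v` non-neighbours
other than itself. -/
theorem two_mul_indepCount_two_ge {V : Type*} [Fintype V] (G : SimpleGraph V)
    [DecidableRel G.Adj] :
    (Fintype.card V : ℤ) * (Fintype.card V - 1) - 2 * G.edgeFinset.card ≤
      2 * indepCount G Finset.univ 2 := by
  classical
  have h := sum_card_extVerts G Finset.univ 1
  rw [indepFam_one, Finset.sum_map] at h
  have h2 : ∀ v : V, (Fintype.card V : ℤ) - 1 - G.degree v ≤
      (extVerts G Finset.univ {v}).card := by
    intro v
    have hs : (Finset.univ : Finset V) ⊆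
        extVerts G Finset.univ {v} ∪ ({v} ∪ G.neighborFinset v) := by
      intro x _
      simp only [Finset.mem_union, mem_extVerts, Finset.mem_univ, true_and,
        Finset.mem_singleton, SimpleGraph.mem_neighborFinset]
      by_cases hx : x = v
      · simp [hx]
      by_cases hadj : G.Adj v x
      · simp [hadj]
      left
      refine ⟨hx, ?_⟩
      intro a ha b hb hab
      simp only [Finset.coe_insert, Finset.coe_singleton, Set.mem_insert_iff,
        Set.mem_singleton_iff] at ha hb
      rcases ha with rfl | rfl <;> rcases hb with rfl | rfl
      · exact absurd rfl hab
      · exact fun h => hadj h.symm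
      · exact hadj
      · exact absurd rfl hab
    have h3 := Finset.card_le_card hs
    have h4 := Finset.card_union_le (extVerts G Finset.univ {v}) ({v} ∪ G.neighborFinset v)
    have h5 := Finset.card_union_le ({v} : Finset V) (G.neighborFinset v)
    rw [Finset.card_univ] at h3
    rw [Finset.card_singleton, SimpleGraph.card_neighborFinset_eq_degree] at h5
    omega
  have h3 := Finset.sum_le_sum fun (v : V) (_ : v ∈ Finset.univ) => h2 v
  rw [Finset.sum_sub_distrib] at h3
  have h4 := G.sum_degrees_eq_twice_card_edges
  have h5 : (∑ v : V, (G.degree v : ℤ)) = 2 * G.edgeFinset.card := by exact_mod_cast h4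
  have h6 : (∑ v : V, ((extVerts G Finset.univ {v}).card : ℤ)) =
      2 * indepCount G Finset.univ 2 := by exact_mod_cast h
  rw [h5, h6] at h3
  simp only [Finset.sum_const, Finset.card_univ, nsmul_eq_mul] at h3
  linarith

/-! ### Ratios of consecutive independent set counts. -/

theorem moon_moser_real {V : Type*} (G : SimpleGraph V) (W : Finset V) (p : ℕ) :
    (((p : ℝ) + 1) * indepCount G W (p + 1)) ^ 2 ≤
      indepCount G W p *
        (W.card * indepCount G W (p + 1) + p * (p + 2) * indepCount G W (p + 2)) := by
  exact_mod_cast moon_moser G W p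

/-- In a graph with at most `n * k` edges, the number of extensions of an independent `s`-set
is on average at least `n - s * (2 * k + 1)`. -/
theorem indepCount_succ_ge {V : Type*} [Fintype V] (G : SimpleGraph V) [DecidableRel G.Adj]
    {k : ℕ} (hE : G.edgeFinset.card ≤ Fintype.card V * k)
    (hn : (k : ℝ) * (2 * k + 1) < Fintype.card V) (s : ℕ) (hs : s ≤ k) :
    0 < indepCount G Finset.univ s ∧
      ((Fintype.card V : ℝ) - s * (2 * k + 1)) * indepCount G Finset.univ s ≤
        (s + 1) * indepCount G Finset.univ (s + 1) := by
  have hpos : ∀ s : ℕ, s ≤ k → 0 < (Fintype.card V : ℝ) - s * (2 * k + 1) := by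
    intro s hs
    have : (s : ℝ) ≤ k := by exact_mod_cast hs
    nlinarith [(Nat.cast_nonneg k : (0 : ℝ) ≤ k)]
  induction s with
  | zero => simp [indepCount_zero, indepCount_one]
  | succ s ih =>
    obtain ⟨ih1, ih2⟩ := ih (by omega)
    have ih1' : (0 : ℝ) < indepCount G Finset.univ s := by exact_mod_cast ih1
    have h1 : (0 : ℝ) < indepCount G Finset.univ (s + 1) := by
      have := mul_pos (hpos s (by omega)) ih1'
      by_contra h
      have h0 : (0 : ℝ) ≤ s := Nat.cast_nonneg s
      nlinarith
    refine ⟨by exact_mod_cast h1, ?_⟩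
    -- Moon–Moser with `p = 0` says nothing about pairs, because the coefficient `p * (p + 2)`
    -- vanishes. The bound for pairs therefore comes from the number of edges, and all later levels
    -- follow from it.
    rcases Nat.eq_zero_or_pos s with rfl | hs0
    · have h2 := two_mul_indepCount_two_ge G
      have h2' : (Fintype.card V : ℝ) * (Fintype.card V - 1) - 2 * G.edgeFinset.card ≤
          2 * indepCount G Finset.univ 2 := by exact_mod_cast h2
      have hE' : (G.edgeFinset.card : ℝ) ≤ Fintype.card V * k := by exact_mod_cast hE
      simp only [zero_add, indepCount_one, Finset.card_univ, Nat.cast_one]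
      norm_num
      nlinarith
    · have hm := moon_moser_real G Finset.univ s
      rw [Finset.card_univ] at hm
      have hs0' : (0 : ℝ) < s := by exact_mod_cast hs0
      set x : ℝ := ((indepCount G Finset.univ s : ℕ) : ℝ)
      set y : ℝ := ((indepCount G Finset.univ (s + 1) : ℕ) : ℝ)
      set z : ℝ := ((indepCount G Finset.univ (s + 2) : ℕ) : ℝ)
      set n : ℝ := ((Fintype.card V : ℕ) : ℝ)
      have h3 : (s + 1) * y * ((n - s * (2 * k + 1)) * x) ≤ (((s : ℝ) + 1) * y) ^ 2 := by
        rw [sq]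
        exact mul_le_mul_of_nonneg_left ih2 (by positivity)
      have h4 : (s + 1) * y * (n - s * (2 * k + 1)) ≤ n * y + s * (s + 2) * z := by
        refine le_of_mul_le_mul_left ?_ ih1'
        linarith
      have h5 : (s : ℝ) * ((n - (s + 1) * (2 * k + 1)) * y) ≤ s * ((s + 2) * z) := by
        linarith
      have h6 := le_of_mul_le_mul_left h5 hs0'
      push_cast
      linarith

/-- A small number of extensions at level `M` forces a linear decrease at all lower levels. -/
theorem indepCount_succ_le {V : Type*} (G : SimpleGraph V) (W : Finset V) {M : ℕ} {δ : ℝ}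
    (hM : 0 < indepCount G W M)
    (h : ((M : ℝ) + 1) * indepCount G W (M + 1) ≤ (W.card - M * δ) * indepCount G W M)
    (q : ℕ) (hq : q ≤ M) :
    ((q : ℝ) + 1) * indepCount G W (q + 1) ≤ (W.card - q * δ) * indepCount G W q := by
  induction hq using Nat.decreasingInduction with
  | self => exact h
  | of_succ q hq ih =>
    have hm := moon_moser_real G W q
    have hy : (0 : ℝ) < indepCount G W (q + 1) := by
      exact_mod_cast indepCount_pos_of_le hq hM
    have hx : (0 : ℝ) ≤ indepCount G W q := Nat.cast_nonneg _
    push_cast at ih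
    set x : ℝ := ((indepCount G W q : ℕ) : ℝ)
    set y : ℝ := ((indepCount G W (q + 1) : ℕ) : ℝ)
    set z : ℝ := ((indepCount G W (q + 1 + 1) : ℕ) : ℝ)
    have hq0 : (0 : ℝ) ≤ q := Nat.cast_nonneg q
    -- This is the identity `w + q (w - (q + 1) δ) = (q + 1) (w - q δ)` with `w = W.card`, which
    -- reproduces the linear bound one level lower.
    have h1 : W.card * y + q * (q + 2) * z ≤ (q + 1) * ((W.card - q * δ) * y) := by
      have := mul_le_mul_of_nonneg_left ih hq0
      nlinarith
    have h2 : (((q : ℝ) + 1) * y) ^ 2 ≤ x * ((q + 1) * ((W.card - q * δ) * y)) :=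
      hm.trans (mul_le_mul_of_nonneg_left h1 hx)
    have h3 : (((q : ℝ) + 1) * y) * ((q + 1) * y) ≤ ((q + 1) * y) * ((W.card - q * δ) * x) := by
      nlinarith
    exact le_of_mul_le_mul_left h3 (by positivity)

/-- Comparison of the number of independent `q`-sets of `W` with that of the whole graph, when
the independent `M`-sets of `W` have few extensions. -/
theorem indepCount_le_mul_exp {V : Type*} [Fintype V] (G : SimpleGraph V) [DecidableRel G.Adj]
    {k : ℕ} (hE : G.edgeFinset.card ≤ Fintype.card V * k)
    (hn : (k : ℝ) * (2 * k + 1) < Fintype.card V) (W : Finset V) {M : ℕ} {θ D : ℝ}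
    (hMk : M ≤ k) (hM : 0 < indepCount G W M)
    (h : ((M : ℝ) + 1) * indepCount G W (M + 1) ≤ θ * indepCount G W M)
    (hD : 0 ≤ D) (hθ : θ + D ≤ Fintype.card V - k * (2 * k + 1)) (q : ℕ) (hq : q ≤ M) :
    (indepCount G W q : ℝ) ≤ indepCount G Finset.univ q *
      Real.exp (-(D / (k * Fintype.card V) * (q * (q - 1) / 2))) := by
  rcases Nat.eq_zero_or_pos M with rfl | hM0
  · obtain rfl : q = 0 := by omega
    simp [indepCount_zero]
  have hM0' : (0 : ℝ) < M := by exact_mod_cast hM0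
  have hMk' : (M : ℝ) ≤ k := by exact_mod_cast hMk
  have hk0 : (0 : ℝ) < k := by linarith
  have hW : (W.card : ℝ) ≤ Fintype.card V := by exact_mod_cast Finset.card_le_univ W
  set n : ℝ := ((Fintype.card V : ℕ) : ℝ) with hn_def
  have hn0 : 0 < n := by nlinarith
  -- This `δ` makes the linear bound interpolate between `W.card` at level 0 and `θ` at level `M`.
  have hdown := indepCount_succ_le G W (M := M) (δ := (W.card - θ) / M) hM (by
    convert h using 2
    field_simp
    ring)
  induction q with
  | zero => simp [indepCount_zero]
  | succ q ih =>
    have ih := ih (by omega)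
    have hqM : (q : ℝ) ≤ M := by exact_mod_cast (by omega : q ≤ M)
    have h1 := hdown q (by omega)
    obtain ⟨-, h2⟩ := indepCount_succ_ge G hE hn q (by omega)
    rw [← hn_def] at h2
    have hq0 : (0 : ℝ) ≤ q := Nat.cast_nonneg q
    set x : ℝ := q * (D / (k * n)) with hx
    have hx0 : 0 ≤ x := by positivity
    have hg0 : 0 ≤ n - q * (2 * k + 1) := by nlinarith
    -- The interpolated bound is at most `n - (q / k) (n - θ)`, hence at most `n - q (2k + 1) - q D
    -- / k`. Compared with the guaranteed `n - q (2k + 1)` extensions in the whole graph, level `q`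
    -- loses a factor `1 - x`. The product of the factors `exp (-x)` gives the quadratic exponent.
    have h3 : W.card - q * ((W.card - θ) / M) ≤ (n - q * (2 * k + 1)) * (1 - x) := by
      have e1 : W.card - q * ((W.card - θ) / M) = W.card * (1 - q / M) + q / M * θ := by ring
      have e2 : W.card * (1 - q / M) + q / M * θ ≤ n * (1 - q / M) + q / M * θ := by
        have : (q : ℝ) / M ≤ 1 := by rw [div_le_one hM0']; exact hqM
        nlinarith
      have e3 : n * (1 - q / M) + q / M * θ = n - q / M * (n - θ) := by ring
      have hnθ : D + k * (2 * k + 1) ≤ n - θ := by linarith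
      have e4 : (q : ℝ) / k * (n - θ) ≤ q / M * (n - θ) := by
        refine mul_le_mul_of_nonneg_right ?_ (by nlinarith)
        exact div_le_div_of_nonneg_left hq0 hM0' hMk'
      have e5 : (q : ℝ) / k * (D + k * (2 * k + 1)) ≤ q / k * (n - θ) :=
        mul_le_mul_of_nonneg_left hnθ (by positivity)
      have e6 : (q : ℝ) / k * (D + k * (2 * k + 1)) = q / k * D + q * (2 * k + 1) := by
        field_simp
      have e7 : n * x = q / k * D := by
        rw [hx]; field_simp
      have e8 : q * (2 * k + 1) * x ≥ 0 := by positivity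
      nlinarith
    have h4 : 1 - x ≤ Real.exp (-x) := by
      have := Real.add_one_le_exp (-x)
      linarith
    have hq1 : (0 : ℝ) < q + 1 := by positivity
    have key : ((q : ℝ) + 1) * indepCount G W (q + 1) ≤
        (q + 1) * (indepCount G Finset.univ (q + 1) * (Real.exp (-x) *
          Real.exp (-(D / (k * n) * (q * (q - 1) / 2))))) := by
      calc ((q : ℝ) + 1) * indepCount G W (q + 1)
          ≤ (W.card - q * ((W.card - θ) / M)) * indepCount G W q := h1
        _ ≤ ((n - q * (2 * k + 1)) * (1 - x)) * indepCount G W q := by gcongr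
        _ ≤ ((n - q * (2 * k + 1)) * Real.exp (-x)) * indepCount G W q := by gcongr
        _ ≤ ((n - q * (2 * k + 1)) * Real.exp (-x)) * (indepCount G Finset.univ q *
              Real.exp (-(D / (k * n) * (q * (q - 1) / 2)))) := by gcongr
        _ = ((n - q * (2 * k + 1)) * indepCount G Finset.univ q) * (Real.exp (-x) *
              Real.exp (-(D / (k * n) * (q * (q - 1) / 2)))) := by ring
        _ ≤ ((q + 1) * indepCount G Finset.univ (q + 1)) * (Real.exp (-x) *
              Real.exp (-(D / (k * n) * (q * (q - 1) / 2)))) := by gcongr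
        _ = _ := by ring
    have key2 := le_of_mul_le_mul_left key hq1
    rw [← Real.exp_add] at key2
    have hexp : -(D / (k * n) * (((q + 1 : ℕ) : ℝ) * (((q + 1 : ℕ) : ℝ) - 1) / 2)) =
        -x + -(D / (k * n) * (q * (q - 1) / 2)) := by
      rw [hx]
      push_cast
      ring
    rw [hexp]
    exact key2

/-! ### The effect of deleting a small set of vertices. -/

theorem indepCount_sub_le_pow_mul {V : Type*} (G : SimpleGraph V) (W : Finset V) {c : ℝ}
    (hc : 0 ≤ c) {r j : ℕ} (hj : j ≤ r)
    (h : ∀ m, r - j ≤ m → m < r → (indepCount G W m : ℝ) ≤ c * indepCount G W (m + 1)) :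
    (indepCount G W (r - j) : ℝ) ≤ c ^ j * indepCount G W r := by
  induction j with
  | zero => simp
  | succ j ih =>
    have h1 := ih (by omega) (fun m hm hm' => h m (by omega) hm')
    have h2 := h (r - (j + 1)) le_rfl (by omega)
    rw [show r - (j + 1) + 1 = r - j by omega] at h2
    calc (indepCount G W (r - (j + 1)) : ℝ) ≤ c * indepCount G W (r - j) := h2
      _ ≤ c * (c ^ j * indepCount G W r) := by gcongr
      _ = _ := by ring

theorem indepCount_le_mul_succ {V : Type*} [Fintype V] (G : SimpleGraph V) [DecidableRel G.Adj]
    {k : ℕ} (hE : G.edgeFinset.card ≤ Fintype.card V * k)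
    (hn : (k : ℝ) * (2 * k + 1) < Fintype.card V) {θ : ℝ} (hθ0 : 0 < θ)
    (hθ : θ ≤ Fintype.card V - k * (2 * k + 1)) (m : ℕ) (hm : m < k) :
    (indepCount G Finset.univ m : ℝ) ≤ k / θ * indepCount G Finset.univ (m + 1) := by
  obtain ⟨-, h⟩ := indepCount_succ_ge G hE hn m hm.le
  have hm' : (m : ℝ) + 1 ≤ k := by exact_mod_cast hm
  have h1 : θ * indepCount G Finset.univ m ≤ k * indepCount G Finset.univ (m + 1) := by
    have hk : (0 : ℝ) ≤ k := Nat.cast_nonneg k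
    calc θ * indepCount G Finset.univ m
        ≤ ((Fintype.card V : ℝ) - m * (2 * k + 1)) * indepCount G Finset.univ m := by
          gcongr
          nlinarith
      _ ≤ _ := h
      _ ≤ _ := by gcongr
  rw [div_mul_eq_mul_div, le_div_iff₀ hθ0]
  linarith

theorem indepCount_le_pow_mul_sub {V : Type*} [Fintype V] (G : SimpleGraph V) (W : Finset V)
    {r i : ℕ} :
    (indepCount G W (r + i) : ℝ) ≤ (Fintype.card V : ℝ) ^ i * indepCount G W r := by
  induction i with
  | zero => simp
  | succ i ih =>
    have h1 := succ_mul_indepCount_le G W (r + i)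
    have h2 : indepCount G W (r + i + 1) ≤ Fintype.card V * indepCount G W (r + i) := by
      refine le_trans ?_ (h1.trans (Nat.mul_le_mul (Finset.card_le_univ W) le_rfl))
      exact Nat.le_mul_of_pos_left _ (by omega)
    have h3 : (indepCount G W (r + i + 1) : ℝ) ≤ Fintype.card V * indepCount G W (r + i) := by
      exact_mod_cast h2
    calc (indepCount G W (r + (i + 1)) : ℝ) ≤ Fintype.card V * indepCount G W (r + i) := h3
      _ ≤ Fintype.card V * ((Fintype.card V : ℝ) ^ i * indepCount G W r) := by gcongr
      _ = _ := by ring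

theorem indepCount_le_sum_sdiff {V : Type*} [DecidableEq V] (G : SimpleGraph V) (W B : Finset V)
    (r : ℕ) :
    indepCount G W r ≤
      ∑ j ∈ Finset.range (r + 1), B.card.choose j * indepCount G (W \ B) (r - j) := by
  have hsub : indepFam G W r ⊆ (Finset.range (r + 1)).biUnion fun j =>
      (B.powersetCard j ×ˢ indepFam G (W \ B) (r - j)).image fun x => x.1 ∪ x.2 := by
    intro A hA
    obtain ⟨h1, h2, h3⟩ := mem_indepFam.1 hA
    have hc := Finset.card_inter_add_card_sdiff A B
    simp only [Finset.mem_biUnion, Finset.mem_image, Finset.mem_product, Finset.mem_range,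
      Finset.mem_powersetCard, mem_indepFam, Prod.exists]
    refine ⟨(A ∩ B).card, by omega, A ∩ B, A \ B, ⟨⟨Finset.inter_subset_right, rfl⟩,
      Finset.sdiff_subset_sdiff h1 le_rfl, by omega, isIndepSet_mono ?_ h3⟩, ?_⟩
    · exact Finset.coe_subset.2 Finset.sdiff_subset
    · ext x
      simp only [Finset.mem_union, Finset.mem_inter, Finset.mem_sdiff]
      tauto
  refine (Finset.card_le_card hsub).trans (Finset.card_biUnion_le.trans ?_)
  refine Finset.sum_le_sum fun j _ => Finset.card_image_le.trans ?_
  rw [Finset.card_product, Finset.card_powersetCard, indepCount]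

theorem sum_choose_mul_pow_le_exp (k r : ℕ) (hr : r ≤ k) {x : ℝ} (hx : 0 ≤ x) :
    ∑ j ∈ Finset.range (r + 1), (k.choose j : ℝ) * x ^ j ≤ Real.exp (k * x) := by
  calc ∑ j ∈ Finset.range (r + 1), (k.choose j : ℝ) * x ^ j
      ≤ ∑ j ∈ Finset.range (k + 1), (k.choose j : ℝ) * x ^ j := by
        refine Finset.sum_le_sum_of_subset_of_nonneg ?_ fun _ _ _ => by positivity
        exact Finset.range_subset_range.2 (by omega)
    _ = (x + 1) ^ k := by
        rw [add_pow]
        refine Finset.sum_congr rfl fun j _ => ?_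
        simp [mul_comm]
    _ ≤ Real.exp x ^ k := by
        gcongr
        exact Real.add_one_le_exp x
    _ = _ := by rw [← Real.exp_nat_mul]

/-- Either removing `B` from `W` does not decrease the number of independent `r`-sets by much,
or this number is negligible. -/
theorem indepCount_dichotomy {V : Type*} [Fintype V] [DecidableEq V] (G : SimpleGraph V)
    [DecidableRel G.Adj]
    {k : ℕ} (hE : G.edgeFinset.card ≤ Fintype.card V * k)
    (hn : (k : ℝ) * (2 * k + 1) < Fintype.card V) {θ D : ℝ} (hθ0 : 0 < θ) (hD : 0 ≤ D)
    (hθ : θ + D ≤ Fintype.card V - k * (2 * k + 1)) (W B : Finset V) (hB : B.card ≤ k)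
    {r J : ℕ} (hrk : r ≤ k) (hJ : J ≤ r) :
    (indepCount G W r : ℝ) ≤ Real.exp (k * (k / θ)) * indepCount G (W \ B) r +
        Real.exp (k * (Real.exp 1 * (k / θ))) * Real.exp (-J) * indepCount G Finset.univ r ∨
      (indepCount G W r : ℝ) ≤ Real.exp 1 * (Fintype.card V : ℝ) ^ J *
          (indepCount G Finset.univ (r - J) *
            Real.exp (-(D / (k * Fintype.card V) *
              ((r - J : ℕ) * ((r - J : ℕ) - 1) / 2)))) +
        Real.exp (k * (Real.exp 1 * (k / θ))) * Real.exp (-J) * indepCount G Finset.univ r := by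
  have hsum : (indepCount G W r : ℝ) ≤
      ∑ j ∈ Finset.range (r + 1), (k.choose j : ℝ) * indepCount G (W \ B) (r - j) := by
    have h := indepCount_le_sum_sdiff G W B r
    have h' : (indepCount G W r : ℝ) ≤
      ∑ j ∈ Finset.range (r + 1), (B.card.choose j : ℝ) * indepCount G (W \ B) (r - j) := by
      exact_mod_cast h
    refine h'.trans (Finset.sum_le_sum fun j _ => ?_)
    gcongr
  set c : ℝ := k / θ with hc
  have hc0 : 0 ≤ c := by positivity
  have hkn : (k : ℝ) ≤ Fintype.card V := by
    nlinarith [(Nat.cast_nonneg k : (0 : ℝ) ≤ k)]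
  set a : ℕ → ℝ := fun m => indepCount G (W \ B) m with ha
  set N : ℝ := ((indepCount G Finset.univ r : ℕ) : ℝ) with hN
  -- For `j > J` the factor `exp (j - J) ≥ 1` is inserted, so that the tail is bounded by a full
  -- binomial sum times `exp (-J)`.
  have htail : ∀ j ∈ Finset.range (r + 1), J < j →
      (k.choose j : ℝ) * a (r - j) ≤
        (k.choose j : ℝ) * (Real.exp 1 * c) ^ j * (Real.exp (-J) * N) := by
    intro j hj hJj
    have hj' : j ≤ r := by simpa [Nat.lt_succ_iff] using hj
    have h1 : a (r - j) ≤ c ^ j * N := by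
      have h2 := indepCount_sub_le_pow_mul G Finset.univ hc0 hj' (fun m _ hm =>
        indepCount_le_mul_succ G hE hn hθ0 (by linarith) m (by omega))
      refine le_trans ?_ h2
      exact Nat.cast_le.2 (indepCount_mono G (Finset.subset_univ _) _)
    have h3 : (1 : ℝ) ≤ Real.exp 1 ^ j * Real.exp (-J) := by
      rw [← Real.exp_nat_mul, ← Real.exp_add, Real.one_le_exp_iff]
      have : (J : ℝ) ≤ j := by exact_mod_cast hJj.le
      linarith
    calc (k.choose j : ℝ) * a (r - j) ≤ (k.choose j : ℝ) * (c ^ j * N) * 1 := by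
          rw [mul_one]; gcongr
      _ ≤ (k.choose j : ℝ) * (c ^ j * N) * (Real.exp 1 ^ j * Real.exp (-J)) := by gcongr
      _ = _ := by ring
  have hcombine : ∀ x A : ℝ, 0 ≤ x → 0 ≤ A → (∀ j ≤ J, a (r - j) ≤ x ^ j * A) →
      (indepCount G W r : ℝ) ≤ Real.exp (k * x) * A +
        Real.exp (k * (Real.exp 1 * c)) * Real.exp (-J) * N := by
    intro x A hx hA h
    calc (indepCount G W r : ℝ)
        ≤ ∑ j ∈ Finset.range (r + 1), ((k.choose j : ℝ) * x ^ j * A +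
            (k.choose j : ℝ) * (Real.exp 1 * c) ^ j * (Real.exp (-J) * N)) := by
          refine hsum.trans (Finset.sum_le_sum fun j hj => ?_)
          rcases le_or_gt j J with hjJ | hjJ
          · refine le_add_of_le_of_nonneg ?_ (by positivity)
            rw [mul_assoc]
            exact mul_le_mul_of_nonneg_left (h j hjJ) (by positivity)
          · exact le_add_of_nonneg_of_le (by positivity) (htail j hj hjJ)
      _ = (∑ j ∈ Finset.range (r + 1), (k.choose j : ℝ) * x ^ j) * A +
            (∑ j ∈ Finset.range (r + 1), (k.choose j : ℝ) * (Real.exp 1 * c) ^ j) *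
              (Real.exp (-J) * N) := by
          rw [Finset.sum_add_distrib, Finset.sum_mul, Finset.sum_mul]
      _ ≤ Real.exp (k * x) * A + Real.exp (k * (Real.exp 1 * c)) * (Real.exp (-J) * N) := by
          gcongr
          · exact sum_choose_mul_pow_le_exp k r hrk hx
          · exact sum_choose_mul_pow_le_exp k r hrk (by positivity)
      _ = _ := by ring
  -- If all ratios near level `r` are good, the sum over `j ≤ J` is binomial in `c`. Otherwise some
  -- level `M ≥ r - J` averages fewer than `θ` extensions, which makes level `r - J` exponentially
  -- small.
  by_cases hgood : ∀ m, r - J ≤ m → m < r → a m ≤ c * a (m + 1)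
  · left
    refine hcombine c (a r) hc0 (by positivity) fun j hj => ?_
    exact indepCount_sub_le_pow_mul G (W \ B) hc0 (by omega)
      (fun m hm hm' => hgood m (by omega) hm')
  · right
    push Not at hgood
    obtain ⟨M, hM1, hM2, hM3⟩ := hgood
    have hk0 : 0 < k := by omega
    have hk0' : (0 : ℝ) < k := by exact_mod_cast hk0
    have hcard : (0 : ℝ) < Fintype.card V := lt_of_lt_of_le hk0' hkn
    have hMpos : 0 < indepCount G (W \ B) M := by
      have : (0 : ℝ) < a M := lt_of_le_of_lt (by positivity) hM3
      exact Nat.cast_pos.1 this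
    have hM4 : ((M : ℝ) + 1) * indepCount G (W \ B) (M + 1) ≤ θ * indepCount G (W \ B) M := by
      have hMk : (M : ℝ) + 1 ≤ k := by exact_mod_cast (by omega : M + 1 ≤ k)
      have h1 : (k : ℝ) * a (M + 1) ≤ θ * a M := by
        rw [hc, div_mul_eq_mul_div, div_lt_iff₀ hθ0] at hM3
        linarith
      refine le_trans ?_ h1
      gcongr
    have hcmp := indepCount_le_mul_exp G hE hn (W \ B) (by omega) hMpos hM4 hD hθ (r - J) hM1
    -- The crude bound `n ^ (J - j)` from level `r - J` up to level `r - j` corresponds to `x = 1 /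
    -- n`, and then `exp (k x) ≤ exp 1`.
    refine (hcombine (1 / Fintype.card V) ((Fintype.card V : ℝ) ^ J * a (r - J)) (by positivity)
      (by positivity) fun j hj => ?_).trans ?_
    · have h1 := indepCount_le_pow_mul_sub G (W \ B) (r := r - J) (i := J - j)
      rw [show r - J + (J - j) = r - j by omega] at h1
      refine h1.trans (le_of_eq ?_)
      rw [pow_sub₀ _ hcard.ne' hj]
      simp only [ha, one_div, inv_pow]
      ring
    · gcongr ?_ + _
      rw [← mul_assoc]
      gcongr
      rw [mul_one_div, div_le_one hcard]
      exact hkn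

/-! ### Traces and branching. -/

/-- The members of `𝓐` whose trace on `U` is `X`. -/
def traceFam {V : Type*} [DecidableEq V] (𝓐 : Finset (Finset V)) (X U : Finset V) :
    Finset (Finset V) :=
  {A ∈ 𝓐 | A ∩ U = X}

theorem mem_traceFam {V : Type*} [DecidableEq V] {𝓐 : Finset (Finset V)} {X U A : Finset V} :
    A ∈ traceFam 𝓐 X U ↔ A ∈ 𝓐 ∧ A ∩ U = X := by
  simp [traceFam]

/-- Each `F` goes to the branch of the least element `x` of `F ∩ B`. Since `F ∩ U = X` is disjoint
from `B`, this `x` lies outside `U`; by minimality, `F` contains no other element of `B` up to `x`.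
-/
theorem card_traceFam_le_sum {V : Type*} [LinearOrder V] {𝓕 : Finset (Finset V)}
    {X U B : Finset V} (hXB : Disjoint X B) (hB : ∀ F ∈ 𝓕, (F ∩ B).Nonempty) :
    (traceFam 𝓕 X U).card ≤
      ∑ x ∈ B \ U, (traceFam 𝓕 (insert x X) (U ∪ {y ∈ B | y ≤ x})).card := by
  refine (Finset.card_le_card ?_).trans Finset.card_biUnion_le
  intro F hF
  obtain ⟨hF1, hF2⟩ := mem_traceFam.1 hF
  have hne := hB F hF1
  set x := (F ∩ B).min' hne with hx
  have hxm : x ∈ F ∩ B := Finset.min'_mem _ _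
  obtain ⟨hxF, hxB⟩ := Finset.mem_inter.1 hxm
  have hxU : x ∉ U := by
    intro h
    have : x ∈ X := hF2 ▸ Finset.mem_inter.2 ⟨hxF, h⟩
    exact Finset.disjoint_left.1 hXB this hxB
  refine Finset.mem_biUnion.2 ⟨x, Finset.mem_sdiff.2 ⟨hxB, hxU⟩, mem_traceFam.2 ⟨hF1, ?_⟩⟩
  ext y
  simp only [Finset.mem_inter, Finset.mem_union, Finset.mem_filter, Finset.mem_insert]
  constructor
  · rintro ⟨h1, h2 | ⟨h2, h3⟩⟩
    · right
      rw [← hF2]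
      exact Finset.mem_inter.2 ⟨h1, h2⟩
    · left
      exact le_antisymm h3 (Finset.min'_le _ _ (Finset.mem_inter.2 ⟨h1, h2⟩))
  · rintro (rfl | h)
    · exact ⟨hxF, Or.inr ⟨hxB, le_rfl⟩⟩
    · rw [← hF2, Finset.mem_inter] at h
      exact ⟨h.1, Or.inl h.2⟩

/-- The families on the left are pairwise disjoint: the branch of `x` is determined by the least
element of `A` in `B \ U`, and the last family consists of sets without such an element. This gain
over plain branching is what the dichotomy exploits. -/
theorem sum_card_traceFam_add_le {V : Type*} [LinearOrder V] (𝓐 : Finset (Finset V))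
    {X U : Finset V} (hXU : X ⊆ U) (B : Finset V) :
    ∑ x ∈ B \ U, (traceFam 𝓐 (insert x X) (U ∪ {y ∈ B | y ≤ x})).card +
      (traceFam 𝓐 X (U ∪ B)).card ≤ (traceFam 𝓐 X U).card := by
  have hdis : ∀ x ∈ B \ U, ∀ y ∈ B \ U, x < y → Disjoint
      (traceFam 𝓐 (insert x X) (U ∪ {z ∈ B | z ≤ x}))
      (traceFam 𝓐 (insert y X) (U ∪ {z ∈ B | z ≤ y})) := by
    intro x hx y _ hxy
    rw [Finset.disjoint_left]
    intro A hA hA'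
    have h1 := (mem_traceFam.1 hA).2
    have h2 := (mem_traceFam.1 hA').2
    obtain ⟨hxB, hxU⟩ := Finset.mem_sdiff.1 hx
    have hxA : x ∈ A := by
      have : x ∈ A ∩ (U ∪ {z ∈ B | z ≤ x}) := by rw [h1]; exact Finset.mem_insert_self _ _
      exact (Finset.mem_inter.1 this).1
    have hxm : x ∈ insert y X := by
      rw [← h2]
      simp [hxA, hxB, hxy.le]
    rcases Finset.mem_insert.1 hxm with h | h
    · exact hxy.ne h
    · exact hxU (hXU h)
  rw [← Finset.card_biUnion, ← Finset.card_union_of_disjoint]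
  · refine Finset.card_le_card fun A hA => ?_
    rw [mem_traceFam]
    rcases Finset.mem_union.1 hA with hA | hA
    · obtain ⟨x, hx, hA⟩ := Finset.mem_biUnion.1 hA
      obtain ⟨hA1, hA2⟩ := mem_traceFam.1 hA
      refine ⟨hA1, ?_⟩
      ext y
      have hy : y ∈ A ∩ (U ∪ {z ∈ B | z ≤ x}) ↔ y ∈ insert x X := by rw [hA2]
      simp only [Finset.mem_inter, Finset.mem_union, Finset.mem_filter,
        Finset.mem_insert] at hy ⊢
      constructor
      · rintro ⟨h1, h2⟩
        rcases hy.1 ⟨h1, Or.inl h2⟩ with rfl | h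
        · exact absurd h2 (Finset.mem_sdiff.1 hx).2
        · exact h
      · exact fun h => ⟨(hy.2 (Or.inr h)).1, hXU h⟩
    · obtain ⟨hA1, hA2⟩ := mem_traceFam.1 hA
      refine ⟨hA1, ?_⟩
      ext y
      have hy : y ∈ A ∩ (U ∪ B) ↔ y ∈ X := by rw [hA2]
      simp only [Finset.mem_inter, Finset.mem_union] at hy ⊢
      constructor
      · exact fun h => hy.1 ⟨h.1, Or.inl h.2⟩
      · exact fun h => ⟨(hy.2 h).1, hXU h⟩
  · rw [Finset.disjoint_biUnion_left]
    intro x hx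
    rw [Finset.disjoint_left]
    intro A hA hA'
    have h1 := (mem_traceFam.1 hA).2
    have h2 := (mem_traceFam.1 hA').2
    obtain ⟨hxB, hxU⟩ := Finset.mem_sdiff.1 hx
    have hxA : x ∈ A := by
      have : x ∈ A ∩ (U ∪ {z ∈ B | z ≤ x}) := by rw [h1]; exact Finset.mem_insert_self _ _
      exact (Finset.mem_inter.1 this).1
    have hxX : x ∈ X := by
      rw [← h2]
      simp [hxA, hxB]
    exact hxU (hXU hxX)
  · intro x hx y hy hxy
    rcases lt_or_gt_of_ne hxy with h | h
    · exact hdis x hx y hy h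
    · exact (hdis y hy x hx h).symm

/-- Branching over successive transversals: each step either loses a factor `p`, or the branch
is negligible. -/
theorem card_traceFam_le_of_dichotomy {V : Type*} [LinearOrder V] {𝓐 𝓕 : Finset (Finset V)}
    (h𝓕 : 𝓕 ⊆ 𝓐) {k s : ℕ} (hk : 1 ≤ k) {p E : ℝ} (hp : 0 ≤ p) (hE : 0 ≤ E)
    (hcov : ∀ X : Finset V, X.card < s →
      ∃ B : Finset V, B.card ≤ k ∧ Disjoint X B ∧ ∀ F ∈ 𝓕, (F ∩ B).Nonempty)
    (hdich : ∀ X U B : Finset V, X ⊆ U → X.card < s → B.card ≤ k →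
      ((traceFam 𝓐 X U).card : ℝ) - (traceFam 𝓐 X (U ∪ B)).card ≤ p * (traceFam 𝓐 X U).card ∨
        ((traceFam 𝓐 X U).card : ℝ) ≤ E)
    (d : ℕ) : ∀ X U : Finset V, X ⊆ U → X.card + d = s →
      ((traceFam 𝓕 X U).card : ℝ) ≤ p ^ d * (traceFam 𝓐 X U).card + (k : ℝ) ^ d * E := by
  have hmono : ∀ X U : Finset V, ((traceFam 𝓕 X U).card : ℝ) ≤ (traceFam 𝓐 X U).card := by
    intro X U
    exact Nat.cast_le.2 (Finset.card_le_card (Finset.filter_subset_filter _ h𝓕))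
  have hk' : (1 : ℝ) ≤ k := by exact_mod_cast hk
  induction d with
  | zero =>
    intro X U _ _
    simp only [pow_zero, one_mul]
    linarith [hmono X U]
  | succ d ih =>
    intro X U hXU hc
    obtain ⟨B, hBk, hXB, hB⟩ := hcov X (by omega)
    -- In the first case the branches together hold at most a proportion `p` of the current family.
    -- In the second the whole family is at most `E`, and `k ^ (d + 1)` copies of `E` are allowed
    -- for.
    rcases hdich X U B hXU (by omega) hBk with h | h
    · have h1 : ((traceFam 𝓕 X U).card : ℝ) ≤
          ∑ x ∈ B \ U, ((traceFam 𝓕 (insert x X) (U ∪ {y ∈ B | y ≤ x})).card : ℝ) := by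
        exact_mod_cast card_traceFam_le_sum hXB hB
      have h2 : ∑ x ∈ B \ U, ((traceFam 𝓐 (insert x X) (U ∪ {y ∈ B | y ≤ x})).card : ℝ) +
          (traceFam 𝓐 X (U ∪ B)).card ≤ (traceFam 𝓐 X U).card := by
        exact_mod_cast sum_card_traceFam_add_le 𝓐 hXU B
      have h3 : ∀ x ∈ B \ U,
          ((traceFam 𝓕 (insert x X) (U ∪ {y ∈ B | y ≤ x})).card : ℝ) ≤
          p ^ d * (traceFam 𝓐 (insert x X) (U ∪ {y ∈ B | y ≤ x})).card + (k : ℝ) ^ d * E := by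
        intro x hx
        obtain ⟨hxB, hxU⟩ := Finset.mem_sdiff.1 hx
        refine ih _ _ ?_ ?_
        · refine Finset.insert_subset ?_ (hXU.trans Finset.subset_union_left)
          simp [hxB]
        · rw [Finset.card_insert_of_notMem fun h => hxU (hXU h)]
          omega
      have h4 : ((B \ U).card : ℝ) ≤ k := by
        exact_mod_cast (Finset.card_le_card Finset.sdiff_subset).trans hBk
      have h5 := h1.trans (Finset.sum_le_sum h3)
      rw [Finset.sum_add_distrib, ← Finset.mul_sum, Finset.sum_const, nsmul_eq_mul] at h5
      calc ((traceFam 𝓕 X U).card : ℝ) ≤ _ := h5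
        _ ≤ p ^ d * (p * (traceFam 𝓐 X U).card) + k * ((k : ℝ) ^ d * E) := by
          gcongr
          linarith
        _ = _ := by ring
    · refine (hmono X U).trans (h.trans ?_)
      refine le_add_of_nonneg_of_le (by positivity) ?_
      exact le_mul_of_one_le_left hE (one_le_pow₀ hk')

/-- Plain branching over successive transversals. -/
theorem card_filter_superset_le_pow_mul {V : Type*} [DecidableEq V] {𝓕 : Finset (Finset V)}
    {k s E : ℕ}
    (hcov : ∀ X : Finset V, X.card < s →
      ∃ B : Finset V, B.card ≤ k ∧ Disjoint X B ∧ ∀ F ∈ 𝓕, (F ∩ B).Nonempty)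
    (hE : ∀ X : Finset V, X.card = s → (𝓕.filter (X ⊆ ·)).card ≤ E) (d : ℕ) :
    ∀ X : Finset V, X.card + d = s → (𝓕.filter (X ⊆ ·)).card ≤ k ^ d * E := by
  induction d with
  | zero =>
    intro X hX
    simpa using hE X hX
  | succ d ih =>
    intro X hX
    obtain ⟨B, hBk, hXB, hB⟩ := hcov X (by omega)
    have hsub : 𝓕.filter (X ⊆ ·) ⊆ B.biUnion fun x => 𝓕.filter (insert x X ⊆ ·) := by
      intro F hF
      obtain ⟨hF1, hF2⟩ := Finset.mem_filter.1 hF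
      obtain ⟨x, hx⟩ := hB F hF1
      obtain ⟨hxF, hxB⟩ := Finset.mem_inter.1 hx
      exact Finset.mem_biUnion.2 ⟨x, hxB, Finset.mem_filter.2
        ⟨hF1, Finset.insert_subset hxF hF2⟩⟩
    refine (Finset.card_le_card hsub).trans (Finset.card_biUnion_le.trans ?_)
    refine (Finset.sum_le_card_nsmul _ _ (k ^ d * E) fun x hx => ih _ ?_).trans ?_
    · rw [Finset.card_insert_of_notMem fun h => Finset.disjoint_left.1 hXB h hx]
      omega
    · rw [smul_eq_mul, pow_succ']
      calc B.card * (k ^ d * E) ≤ k * (k ^ d * E) := Nat.mul_le_mul_right _ hBk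
        _ = _ := by ring

theorem card_filter_superset_le_indepCount {V : Type*} [Fintype V] [DecidableEq V]
    (G : SimpleGraph V) (X : Finset V) (k : ℕ) :
    ((indepFam G Finset.univ k).filter (X ⊆ ·)).card ≤
      indepCount G Finset.univ (k - X.card) := by
  refine Finset.card_le_card_of_injOn (fun A => A \ X) ?_ ?_
  · intro A hA
    obtain ⟨hA1, hA2⟩ := Finset.mem_filter.1 hA
    obtain ⟨-, h2, h3⟩ := mem_indepFam.1 hA1
    refine mem_indepFam.2 ⟨Finset.subset_univ _, ?_, isIndepSet_mono ?_ h3⟩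
    · rw [Finset.card_sdiff_of_subset hA2, h2]
    · exact Finset.coe_subset.2 Finset.sdiff_subset
  · intro A hA A' hA' h
    have hA2 := (Finset.mem_filter.1 hA).2
    have hA2' := (Finset.mem_filter.1 hA').2
    have h' : A \ X = A' \ X := h
    rw [← Finset.sdiff_union_of_subset hA2, h', Finset.sdiff_union_of_subset hA2']

/-- The independent sets with trace `X` on `U` correspond to the independent sets of the graph
with `U` and the neighbours of `X` deleted. -/
theorem exists_card_traceFam_eq {V : Type*} [Fintype V] [DecidableEq V] (G : SimpleGraph V)
    {X U : Finset V} (hXU : X ⊆ U) (hX : G.IsIndepSet (X : Set V)) {k : ℕ} (hk : X.card ≤ k) :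
    ∃ W : Finset V, ∀ B : Finset V, (traceFam (indepFam G Finset.univ k) X (U ∪ B)).card =
      indepCount G (W \ B) (k - X.card) := by
  classical
  -- This `W` does not depend on `B`, so `B = ∅` and the actual `B` can be compared inside the same
  -- `W`.
  refine ⟨({v | v ∉ U ∧ ∀ x ∈ X, ¬ G.Adj x v} : Finset V), fun B => ?_⟩
  refine Finset.card_bij' (fun A _ => A \ X) (fun C _ => C ∪ X) ?_ ?_ ?_ ?_
  · intro A hA
    obtain ⟨hA1, hA2⟩ := mem_traceFam.1 hA
    obtain ⟨-, h2, h3⟩ := mem_indepFam.1 hA1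
    have hXA : X ⊆ A := hA2 ▸ Finset.inter_subset_left
    refine mem_indepFam.2 ⟨?_, by rw [Finset.card_sdiff_of_subset hXA, h2],
      isIndepSet_mono (Finset.coe_subset.2 Finset.sdiff_subset) h3⟩
    intro v hv
    obtain ⟨hvA, hvX⟩ := Finset.mem_sdiff.1 hv
    have hvUB : v ∉ U ∪ B := fun h => hvX (hA2 ▸ Finset.mem_inter.2 ⟨hvA, h⟩)
    rw [Finset.mem_union, not_or] at hvUB
    simp only [Finset.mem_sdiff, Finset.mem_filter, Finset.mem_univ, true_and]
    refine ⟨⟨hvUB.1, fun x hx => ?_⟩, hvUB.2⟩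
    exact h3 (hXA hx) hvA fun h => hvX (h ▸ hx)
  · intro C hC
    obtain ⟨h1, h2, h3⟩ := mem_indepFam.1 hC
    have hCp : ∀ v ∈ C, v ∉ U ∧ v ∉ B ∧ ∀ x ∈ X, ¬ G.Adj x v := by
      intro v hv
      have := h1 hv
      simp only [Finset.mem_sdiff, Finset.mem_filter, Finset.mem_univ, true_and] at this
      tauto
    have hdis : Disjoint C X :=
      Finset.disjoint_left.2 fun v hv hvX => (hCp v hv).1 (hXU hvX)
    refine mem_traceFam.2 ⟨mem_indepFam.2 ⟨Finset.subset_univ _, ?_, ?_⟩, ?_⟩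
    · rw [Finset.card_union_of_disjoint hdis, h2]
      omega
    · intro x hx y hy hxy
      simp only [Finset.coe_union, Set.mem_union, Finset.mem_coe] at hx hy
      rcases hx with hx | hx <;> rcases hy with hy | hy
      · exact h3 hx hy hxy
      · exact fun h => (hCp x hx).2.2 y hy h.symm
      · exact (hCp y hy).2.2 x hx
      · exact hX hx hy hxy
    · ext v
      simp only [Finset.mem_inter, Finset.mem_union]
      constructor
      · rintro ⟨h | h, h'⟩
        · have := hCp v h
          tauto
        · exact h
      · exact fun h => ⟨Or.inr h, Or.inl (hXU h)⟩
  · intro A hA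
    obtain ⟨-, hA2⟩ := mem_traceFam.1 hA
    exact Finset.sdiff_union_of_subset (hA2 ▸ Finset.inter_subset_left)
  · intro C hC
    obtain ⟨h1, -, -⟩ := mem_indepFam.1 hC
    refine Finset.union_sdiff_cancel_right (Finset.disjoint_left.2 fun v hv hvX => ?_)
    have := h1 hv
    simp only [Finset.mem_sdiff, Finset.mem_filter, Finset.mem_univ, true_and] at this
    exact this.1.1 (hXU hvX)

/-! ### The sparse and dense ranges of parameters. -/

theorem exists_disjoint_of_le_coverNumber {V : Type*} [DecidableEq V]
    {𝓖 : Finset (Finset V)} {x : ℝ}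
    (h : ENNReal.ofReal x ≤ ((KneserFamily.coverNumber 𝓖 : ℕ∞) : ℝ≥0∞))
    {X : Finset V} (hX : (X.card : ℝ) < x) : ∃ B ∈ 𝓖, Disjoint X B := by
  by_contra hcon
  push Not at hcon
  have hcov : KneserFamily.IsCover 𝓖 X := by
    intro A hA
    rw [← Finset.not_disjoint_iff_nonempty_inter]
    exact hcon A hA
  have h1 : KneserFamily.coverNumber 𝓖 ≤ X.card := iInf₂_le X hcov
  have h2 : ENNReal.ofReal x ≤ (X.card : ℝ≥0∞) := by
    refine h.trans ?_
    have := ENat.toENNReal_le.2 h1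
    simpa using this
  rw [← ENNReal.ofReal_natCast, ENNReal.ofReal_le_ofReal_iff (Nat.cast_nonneg _)] at h2
  linarith

theorem exp_neg_seven_le : Real.exp (-7) ≤ 1 / 8 := by
  rw [Real.exp_neg, ← one_div]
  refine one_div_le_one_div_of_le (by norm_num) ?_
  linarith [Real.add_one_le_exp (7 : ℝ)]

theorem indepCount_sub_le {V : Type*} [Fintype V] (G : SimpleGraph V) [DecidableRel G.Adj]
    {k : ℕ} (hE : G.edgeFinset.card ≤ Fintype.card V * k)
    (hn : (k : ℝ) * (2 * k + 1) + k ≤ Fintype.card V) (hk : 0 < k) {m : ℕ} (hm : m ≤ k) :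
    (indepCount G Finset.univ m : ℝ) ≤ indepCount G Finset.univ k := by
  have hk' : (0 : ℝ) < k := by exact_mod_cast hk
  have h := indepCount_sub_le_pow_mul G Finset.univ (zero_le_one) (r := k) (j := k - m) (by omega)
    (fun i _ hi => by
      have := indepCount_le_mul_succ G hE (by linarith) hk' (by linarith) i hi
      rwa [div_self hk'.ne'] at this)
  rwa [one_pow, one_mul, Nat.sub_sub_self hm] at h

/-- The bound for sparse parameters, where plain branching suffices. -/
theorem mul_card_lt_of_large {V : Type*} [Fintype V] [DecidableEq V] (G : SimpleGraph V)
    [DecidableRel G.Adj] {k s : ℕ} (hE : G.edgeFinset.card ≤ Fintype.card V * k) (hk : 1 ≤ k)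
    (hn : 8 * (k : ℝ) ^ 2 ≤ Fintype.card V) (hs1 : 1 ≤ s) (hsk : s ≤ k)
    (hs : 2 * Real.log k + 2 < s) {𝓕 : Finset (Finset V)} (h𝓕 : 𝓕 ⊆ indepFam G Finset.univ k)
    (hcov : ∀ X : Finset V, X.card < s →
      ∃ B : Finset V, B.card ≤ k ∧ Disjoint X B ∧ ∀ F ∈ 𝓕, (F ∩ B).Nonempty) :
    (Fintype.card V : ℝ) * 𝓕.card < indepCount G Finset.univ k := by
  have hk' : (1 : ℝ) ≤ k := by exact_mod_cast hk
  have hF := card_filter_superset_le_pow_mul (E := indepCount G Finset.univ (k - s)) hcov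
    (fun X hX => (Finset.card_le_card (Finset.filter_subset_filter _ h𝓕)).trans
      (hX ▸ card_filter_superset_le_indepCount G X k)) s ∅ (by simp)
  simp only [Finset.empty_subset, Finset.filter_true] at hF
  have hF' : (𝓕.card : ℝ) ≤ (k : ℝ) ^ s * indepCount G Finset.univ (k - s) := by
    exact_mod_cast hF
  set n : ℝ := ((Fintype.card V : ℕ) : ℝ) with hn_def
  have hn0 : 0 < n := by nlinarith
  have hlow : n / 2 ≤ n - k * (2 * k + 1) := by nlinarith
  have hlt : (k : ℝ) * (2 * k + 1) < n := by linarith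
  have hN : (0 : ℝ) < indepCount G Finset.univ k := by
    exact_mod_cast (indepCount_succ_ge G hE hlt k le_rfl).1
  have h1 := indepCount_sub_le_pow_mul G Finset.univ (c := k / (n / 2)) (by positivity) hsk
    (fun m _ hm => indepCount_le_mul_succ G hE hlt (by positivity) hlow m hm)
  have h2 : n * ((k : ℝ) ^ s * (k / (n / 2)) ^ s) < 1 := by
    -- One of the `s` factors `2k²/n` absorbs the leading `n`. The other `s - 1` are each at most
    -- `1/4 ≤ exp (-1)` and beat the remaining `2k² ≤ exp (1 + 2 log k)`.
    obtain ⟨u, rfl⟩ : ∃ u, s = u + 1 := ⟨s - 1, by omega⟩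
    have e1 : n * ((k : ℝ) ^ (u + 1) * (k / (n / 2)) ^ (u + 1)) =
        2 * k ^ 2 * (2 * k ^ 2 / n) ^ u := by
      rw [← mul_pow, show (k : ℝ) * (k / (n / 2)) = 2 * k ^ 2 / n by field_simp, pow_succ]
      field_simp
    have e2 : 2 * (k : ℝ) ^ 2 / n ≤ Real.exp (-1) := by
      rw [Real.exp_neg, div_le_iff₀ hn0]
      have h3 : Real.exp 1 ≤ 4 := by linarith [Real.exp_one_lt_d9]
      have h4 : (1 : ℝ) / 4 ≤ (Real.exp 1)⁻¹ := by
        rw [← one_div]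
        exact one_div_le_one_div_of_le (Real.exp_pos 1) h3
      nlinarith
    have e3 : (2 : ℝ) ≤ Real.exp 1 := by linarith [Real.add_one_le_exp (1 : ℝ)]
    have e4 : (k : ℝ) ^ 2 = Real.exp (2 * Real.log k) := by
      rw [mul_comm, Real.exp_mul, Real.exp_log (by linarith)]
      norm_cast
    rw [e1]
    calc 2 * (k : ℝ) ^ 2 * (2 * k ^ 2 / n) ^ u
        ≤ Real.exp 1 * Real.exp (2 * Real.log k) * Real.exp (-1) ^ u := by
          rw [← e4]
          gcongr
      _ = Real.exp (1 + 2 * Real.log k - u) := by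
          rw [← Real.exp_nat_mul, ← Real.exp_add, ← Real.exp_add]
          congr 1
          ring
      _ < 1 := by
          rw [Real.exp_lt_one_iff]
          push_cast at hs
          linarith
  calc n * 𝓕.card ≤ n * ((k : ℝ) ^ s * ((k / (n / 2)) ^ s * indepCount G Finset.univ k)) := by
        gcongr
        exact hF'.trans (by gcongr)
    _ = (n * ((k : ℝ) ^ s * (k / (n / 2)) ^ s)) * indepCount G Finset.univ k := by ring
    _ < 1 * indepCount G Finset.univ k := by gcongr
    _ = _ := one_mul _

/-- The decay exponent of `indepCount_le_mul_exp` for `D = k² / (4L)` at a level `q ≥ k / 2`. It has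
order `k / L` because `n` is at most a constant times `k²`. -/
theorem div_log_le_decay {k L n q : ℝ} (hk : 4 ≤ k) (hL : 0 < L) (hn : 0 < n)
    (hn8 : n ≤ 8 * k ^ 2) (hq : k / 2 ≤ q) :
    k / (512 * L) ≤ k ^ 2 / (4 * L) / (k * n) * (q * (q - 1) / 2) := by
  have hk0 : 0 < k := by linarith
  have hD : 1 / (32 * L * k) ≤ k ^ 2 / (4 * L) / (k * n) := by
    rw [div_div, div_le_div_iff₀ (by positivity) (by positivity)]
    have : 4 * L * k * n ≤ 4 * L * k * (8 * k ^ 2) := by gcongr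
    nlinarith
  have hq2 : k ^ 2 / 16 ≤ q * (q - 1) / 2 := by nlinarith
  calc k / (512 * L) = 1 / (32 * L * k) * (k ^ 2 / 16) := by
        field_simp
        norm_num
    _ ≤ _ := by gcongr

/-- The dichotomy for the families of independent sets with a prescribed trace. -/
theorem traceFam_dichotomy {V : Type*} [Fintype V] [DecidableEq V] (G : SimpleGraph V)
    [DecidableRel G.Adj] {k s J : ℕ} (hE : G.edgeFinset.card ≤ Fintype.card V * k) (hk : 4 ≤ k)
    (hL : 0 < Real.log k) (hLk : 4 * Real.log k ≤ k)
    (hn : (2 + 3 / Real.log k) * (k : ℝ) ^ 2 ≤ Fintype.card V)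
    (hn8 : (Fintype.card V : ℝ) ≤ 8 * k ^ 2) (hsJ : 2 * (s + J) ≤ k)
    (X U B : Finset V) (hXU : X ⊆ U) (hX : X.card < s) (hB : B.card ≤ k) :
    ((traceFam (indepFam G Finset.univ k) X U).card : ℝ) -
        (traceFam (indepFam G Finset.univ k) X (U ∪ B)).card ≤
        (1 - Real.exp (-(2 / 5 * Real.log k)) / 2) *
          (traceFam (indepFam G Finset.univ k) X U).card ∨
      ((traceFam (indepFam G Finset.univ k) X U).card : ℝ) ≤
        (2 * (Real.exp (2 * Real.log k) * Real.exp (-J)) +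
          Real.exp 1 * (Fintype.card V : ℝ) ^ J * Real.exp (-(k / (512 * Real.log k)))) *
        indepCount G Finset.univ k := by
  set L := Real.log k with hLdef
  by_cases hXi : G.IsIndepSet (X : Set V)
  swap
  · right
    have : traceFam (indepFam G Finset.univ k) X U = ∅ := by
      refine Finset.eq_empty_of_forall_notMem fun A hA => hXi ?_
      obtain ⟨hA1, hA2⟩ := mem_traceFam.1 hA
      exact isIndepSet_mono (Finset.coe_subset.2 (hA2 ▸ Finset.inter_subset_left))
        (mem_indepFam.1 hA1).2.2
    rw [this]
    simp only [Finset.card_empty, Nat.cast_zero]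
    positivity
  obtain ⟨W, hW⟩ := exists_card_traceFam_eq G hXU hXi (k := k) (by omega)
  have hW0 := hW ∅
  rw [Finset.union_empty, Finset.sdiff_empty] at hW0
  rw [hW, hW0]
  set r := k - X.card with hr
  have hk' : (4 : ℝ) ≤ k := by exact_mod_cast hk
  have hk0 : (0 : ℝ) < k := by linarith
  set n : ℝ := ((Fintype.card V : ℕ) : ℝ) with hn_def
  have hkL : (k : ℝ) ≤ k ^ 2 / (4 * L) := by
    rw [le_div_iff₀ (by positivity)]
    nlinarith
  have hn' : 2 * (k : ℝ) ^ 2 + 12 * (k ^ 2 / (4 * L)) ≤ n := by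
    refine le_trans (le_of_eq ?_) hn
    field_simp
    ring
  have hθ : 10 * ((k : ℝ) ^ 2 / (4 * L)) + k ^ 2 / (4 * L) ≤ n - k * (2 * k + 1) := by
    nlinarith
  have hlt : (k : ℝ) * (2 * k + 1) < n := by nlinarith
  have hrat : (k : ℝ) * (k / (10 * (k ^ 2 / (4 * L)))) = 2 / 5 * L := by
    field_simp
    norm_num
  -- With `D = k² / (4L)` the hypothesis reads `n ≥ 2k² + 12 D`. One `D` absorbs the linear term
  -- `k`, one is the deficiency, and the remaining ten form `θ`. Then `k · (k / θ) = (2/5) L`, so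
  -- deleting `B` costs a factor `k^(2/5)`, safely below `√k`.
  have hmain := indepCount_dichotomy G hE hlt (θ := 10 * ((k : ℝ) ^ 2 / (4 * L)))
    (D := k ^ 2 / (4 * L)) (by positivity) (by positivity) hθ W B hB (r := r) (J := J)
    (by omega) (by omega)
  rw [← mul_left_comm (Real.exp 1), hrat] at hmain
  set N : ℝ := ((indepCount G Finset.univ k : ℕ) : ℝ) with hN
  have hmono : ∀ m ≤ k, (indepCount G Finset.univ m : ℝ) ≤ N := fun m hm =>
    indepCount_sub_le G hE (by nlinarith) (by omega) hm
  have hT : Real.exp (Real.exp 1 * (2 / 5 * L)) * Real.exp (-J) * indepCount G Finset.univ r ≤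
      Real.exp (2 * L) * Real.exp (-J) * N := by
    have h1 : Real.exp 1 * (2 / 5 * L) ≤ 2 * L := by
      have : Real.exp 1 ≤ 3 := by linarith [Real.exp_one_lt_d9]
      nlinarith
    have h2 := hmono r (by omega)
    gcongr
  have hN0 : 0 ≤ N := Nat.cast_nonneg _
  have hY0 : 0 ≤ Real.exp 1 * n ^ J * Real.exp (-(k / (512 * L))) * N := by positivity
  rcases hmain with h | h
  -- Either the tail term is at least half of the count, which makes the branch negligible, or it
  -- can be dropped at the price of a factor 2.
  · rcases le_or_gt ((indepCount G W r : ℕ) : ℝ) (2 * (Real.exp (2 * L) * Real.exp (-J)) * N)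
      with h2 | h2
    · right
      linarith
    · left
      have h3 : (indepCount G W r : ℝ) / 2 ≤
          Real.exp (2 / 5 * L) * indepCount G (W \ B) r := by linarith
      have h4 := mul_le_mul_of_nonneg_left h3 (Real.exp_pos (-(2 / 5 * L))).le
      rw [← mul_assoc, ← Real.exp_add, neg_add_cancel, Real.exp_zero, one_mul] at h4
      linarith
  · right
    have hq : (k : ℝ) / 2 ≤ (r - J : ℕ) := by
      rw [div_le_iff₀ (by norm_num)]
      exact_mod_cast (by omega : k ≤ (r - J) * 2)
    have hexp : (k : ℝ) / (512 * L) ≤ k ^ 2 / (4 * L) / (k * n) *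
        (((r - J : ℕ) : ℝ) * (((r - J : ℕ) : ℝ) - 1) / 2) :=
      div_log_le_decay hk' hL (lt_of_le_of_lt (by positivity) hlt) hn8 hq
    have h1 : Real.exp 1 * n ^ J * (indepCount G Finset.univ (r - J) *
        Real.exp (-(k ^ 2 / (4 * L) / (k * n) *
          (((r - J : ℕ) : ℝ) * (((r - J : ℕ) : ℝ) - 1) / 2)))) ≤
        Real.exp 1 * n ^ J * (N * Real.exp (-(k / (512 * L)))) := by
      have := hmono (r - J) (by omega)
      gcongr
    have hTT : 0 ≤ Real.exp (2 * L) * Real.exp (-J) * N := by positivity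
    linarith

/-- The numerical inequality behind the dense range of parameters. -/
theorem dense_range_numerics {L y n : ℝ} {s J : ℕ} (hL : 0 < L) (hyL : y = Real.exp (L / 20))
    (hLy : L ≤ y) (hy : 1000 ≤ y)
    (hn0 : 0 ≤ n) (hn : n ≤ 8 * Real.exp L ^ 2)
    (hs : y ^ 10 ≤ s) (hs' : (s : ℝ) ≤ y ^ 10 + 1) (hJ : y ^ 15 ≤ J) (hJ' : (J : ℝ) ≤ y ^ 15 + 1) :
    n * ((1 - Real.exp (-(2 / 5 * L)) / 2) ^ s + Real.exp L ^ s *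
      (2 * (Real.exp (2 * L) * Real.exp (-J)) +
        Real.exp 1 * n ^ J * Real.exp (-(Real.exp L / (512 * L))))) < 1 := by
  have hy0 : 0 < y := by linarith
  have hn' : n ≤ Real.exp (3 + 2 * L) := by
    have h8 : (8 : ℝ) ≤ Real.exp 3 := by
      have h2 : (2 : ℝ) ≤ Real.exp 1 := by linarith [Real.add_one_le_exp (1 : ℝ)]
      calc (8 : ℝ) = 2 ^ 3 := by norm_num
        _ ≤ Real.exp 1 ^ 3 := by gcongr
        _ = Real.exp 3 := by rw [← Real.exp_nat_mul]; norm_num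
    refine hn.trans ?_
    rw [Real.exp_add, two_mul L, Real.exp_add, sq]
    gcongr
  -- In powers of `y = k^(1/20)`: `s` is about `y ^ 10`, `J` about `y ^ 15`, and `L ≤ y`. The three
  -- terms are small because `s k^(-2/5) ≥ y ^ 2` beats `log n`, `J` beats `s L ≤ y ^ 11 + y`, and
  -- `k / (512 L) ≥ y ^ 19 / 512` beats `J log n`, which is of order at most `y ^ 16`.
  have hpow : ∀ m : ℕ, y ^ m = Real.exp (m * (L / 20)) := fun m => by
    rw [hyL, ← Real.exp_nat_mul]
  have hmain : n * (1 - Real.exp (-(2 / 5 * L)) / 2) ^ s ≤ 1 / 8 := by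
    have h1 : 1 - Real.exp (-(2 / 5 * L)) / 2 ≤ Real.exp (-(Real.exp (-(2 / 5 * L)) / 2)) := by
      have := Real.add_one_le_exp (-(Real.exp (-(2 / 5 * L)) / 2))
      linarith
    have h0 : 0 ≤ 1 - Real.exp (-(2 / 5 * L)) / 2 := by
      have : Real.exp (-(2 / 5 * L)) ≤ 1 := Real.exp_le_one_iff.2 (by linarith)
      linarith
    have h2 : y ^ 2 ≤ s * Real.exp (-(2 / 5 * L)) := by
      calc y ^ 2 = y ^ 10 * Real.exp (-(2 / 5 * L)) := by
            rw [hpow, hpow, ← Real.exp_add]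
            congr 1
            push_cast
            ring
        _ ≤ _ := by gcongr
    calc n * (1 - Real.exp (-(2 / 5 * L)) / 2) ^ s
        ≤ Real.exp (3 + 2 * L) * Real.exp (-(Real.exp (-(2 / 5 * L)) / 2)) ^ s := by gcongr
      _ = Real.exp (3 + 2 * L - s * Real.exp (-(2 / 5 * L)) / 2) := by
          rw [← Real.exp_nat_mul, ← Real.exp_add]
          congr 1
          ring
      _ ≤ Real.exp (-7) := by
          refine Real.exp_le_exp.2 ?_
          nlinarith
      _ ≤ 1 / 8 := exp_neg_seven_le
  have hsL : s * L ≤ y ^ 11 + y := by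
    calc s * L ≤ (y ^ 10 + 1) * y := by gcongr
      _ = _ := by ring
  have h1000 : ∀ m : ℕ, 1000 * y ^ m ≤ y ^ (m + 1) := fun m => by
    rw [pow_succ, mul_comm]
    gcongr
  have p11 := h1000 11
  have p12 := h1000 12
  have p13 := h1000 13
  have p14 := h1000 14
  have p15 := h1000 15
  have p16 := h1000 16
  have p17 := h1000 17
  have p18 := h1000 18
  have q1 : y ≤ y ^ 11 := le_self_pow₀ (by linarith) (by norm_num)
  have htail : n * (Real.exp L ^ s * (2 * (Real.exp (2 * L) * Real.exp (-J)))) ≤ 1 / 4 := by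
    calc n * (Real.exp L ^ s * (2 * (Real.exp (2 * L) * Real.exp (-J))))
        ≤ Real.exp (3 + 2 * L) * (Real.exp L ^ s * (2 * (Real.exp (2 * L) * Real.exp (-J)))) := by
          gcongr
      _ = 2 * Real.exp (3 + 2 * L + s * L + 2 * L - J) := by
          rw [mul_left_comm _ 2, mul_left_comm _ 2, ← Real.exp_nat_mul, ← Real.exp_add,
            ← Real.exp_add, ← Real.exp_add]
          congr 2
          ring
      _ ≤ 2 * Real.exp (-7) := by
          refine mul_le_mul_of_nonneg_left (Real.exp_le_exp.2 ?_) (by norm_num)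
          norm_num at p11 p12 p13 p14
          linarith
      _ ≤ 1 / 4 := by linarith [exp_neg_seven_le]
  have hbad : n * (Real.exp L ^ s * (Real.exp 1 * n ^ J *
      Real.exp (-(Real.exp L / (512 * L))))) ≤ 1 / 8 := by
    have h1 : y ^ 19 / 512 ≤ Real.exp L / (512 * L) := by
      have h2 : Real.exp L = y ^ 20 := by
        rw [hpow]
        congr 1
        push_cast
        ring
      rw [h2, div_le_div_iff₀ (by norm_num) (by positivity)]
      have : y ^ 19 * (512 * L) ≤ y ^ 19 * (512 * y) := by gcongr
      linarith [pow_succ y 19]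
    have h2 : J * (3 + 2 * L) ≤ 2 * y ^ 16 + 3 * y ^ 15 + 2 * y + 3 := by
      calc J * (3 + 2 * L) ≤ (y ^ 15 + 1) * (3 + 2 * y) := by gcongr
        _ = _ := by ring
    calc n * (Real.exp L ^ s * (Real.exp 1 * n ^ J * Real.exp (-(Real.exp L / (512 * L)))))
        ≤ Real.exp (3 + 2 * L) * (Real.exp L ^ s * (Real.exp 1 * Real.exp (3 + 2 * L) ^ J *
            Real.exp (-(y ^ 19 / 512)))) := by
          gcongr
      _ = Real.exp (3 + 2 * L + (s * L + (1 + J * (3 + 2 * L) + -(y ^ 19 / 512)))) := by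
          simp only [← Real.exp_nat_mul, ← Real.exp_add]
      _ ≤ Real.exp (-7) := by
          refine Real.exp_le_exp.2 ?_
          norm_num at p11 p12 p13 p14 p15 p16 p17 p18
          linarith
      _ ≤ 1 / 8 := exp_neg_seven_le
  rw [mul_add, mul_add (Real.exp L ^ s), mul_add n]
  linarith

/-- The bound for dense parameters. -/
theorem mul_card_lt_of_dense {V : Type*} [Fintype V] [LinearOrder V] (G : SimpleGraph V)
    [DecidableRel G.Adj] {k s J : ℕ} (hE : G.edgeFinset.card ≤ Fintype.card V * k) (hk : 4 ≤ k)
    (hL : 1 ≤ Real.log k) {y : ℝ} (hyL : y = Real.exp (Real.log k / 20)) (hLy : Real.log k ≤ y)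
    (hy : 1000 ≤ y) (hn : (2 + 3 / Real.log k) * (k : ℝ) ^ 2 ≤ Fintype.card V)
    (hn8 : (Fintype.card V : ℝ) ≤ 8 * k ^ 2)
    (hs : y ^ 10 ≤ s) (hs' : (s : ℝ) ≤ y ^ 10 + 1) (hJ : y ^ 15 ≤ J) (hJ' : (J : ℝ) ≤ y ^ 15 + 1)
    {𝓕 : Finset (Finset V)} (h𝓕 : 𝓕 ⊆ indepFam G Finset.univ k)
    (hcov : ∀ X : Finset V, X.card < s →
      ∃ B : Finset V, B.card ≤ k ∧ Disjoint X B ∧ ∀ F ∈ 𝓕, (F ∩ B).Nonempty) :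
    (Fintype.card V : ℝ) * 𝓕.card < indepCount G Finset.univ k := by
  have hk' : (4 : ℝ) ≤ k := by exact_mod_cast hk
  have hkexp : Real.exp (Real.log k) = k := Real.exp_log (by linarith)
  set L := Real.log k with hLdef
  have hL0 : 0 < L := by linarith
  have hy0 : 0 < y := by linarith
  have hky : (k : ℝ) = y ^ 20 := by
    rw [← hkexp, hyL, ← Real.exp_nat_mul]
    congr 1
    push_cast
    ring
  have hy1 : 1 ≤ y := by linarith
  have hLk : 4 * L ≤ k := by
    have h1 : y ^ 2 ≤ y ^ 20 := pow_le_pow_right₀ hy1 (by norm_num)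
    nlinarith
  have hsJ : 2 * (s + J) ≤ k := by
    have h1 : y ^ 10 ≤ y ^ 15 := pow_le_pow_right₀ hy1 (by norm_num)
    have h2 : y ^ 16 ≤ y ^ 20 := pow_le_pow_right₀ hy1 (by norm_num)
    have h3 : 1 ≤ y ^ 15 := one_le_pow₀ hy1
    have h4 : 1000 * y ^ 15 ≤ y ^ 16 := by
      rw [pow_succ y 15, mul_comm]
      gcongr
    have : (2 : ℝ) * (s + J) ≤ k := by linarith
    exact_mod_cast this
  have hlt : (k : ℝ) * (2 * k + 1) < Fintype.card V := by
    refine lt_of_lt_of_le ?_ hn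
    have h1 : (k : ℝ) < 3 / L * k ^ 2 := by
      rw [div_mul_eq_mul_div, lt_div_iff₀ hL0]
      nlinarith
    nlinarith
  have hN : (0 : ℝ) < indepCount G Finset.univ k := by
    exact_mod_cast (indepCount_succ_ge G hE hlt k le_rfl).1
  have hp : 0 ≤ 1 - Real.exp (-(2 / 5 * L)) / 2 := by
    have : Real.exp (-(2 / 5 * L)) ≤ 1 := Real.exp_le_one_iff.2 (by linarith)
    linarith
  -- Branching starts at `X = U = ∅`, where the trace condition is void, and runs to depth `s`.
  have htree := card_traceFam_le_of_dichotomy h𝓕 (by omega) hp (by positivity) hcov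
    (fun X U B hXU hX hB => traceFam_dichotomy G hE hk hL0 hLk hn hn8 hsJ X U B hXU hX hB)
    s ∅ ∅ le_rfl (by simp)
  have htriv : ∀ 𝓐 : Finset (Finset V), traceFam 𝓐 ∅ ∅ = 𝓐 := fun 𝓐 => by simp [traceFam]
  rw [htriv, htriv, ← hLdef] at htree
  have hnum := dense_range_numerics (n := Fintype.card V) hL0 hyL hLy hy (Nat.cast_nonneg _)
    (by rwa [hkexp]) hs hs' hJ hJ'
  rw [hkexp] at hnum
  set N : ℝ := ((indepCount G Finset.univ k : ℕ) : ℝ) with hNdef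
  have hcard : (((indepFam G Finset.univ k).card : ℕ) : ℝ) = N := rfl
  rw [hcard] at htree
  calc (Fintype.card V : ℝ) * 𝓕.card ≤ Fintype.card V * _ :=
        mul_le_mul_of_nonneg_left htree (Nat.cast_nonneg _)
    _ = _ * N := by
        rw [← mul_assoc ((k : ℝ) ^ s), ← add_mul, ← mul_assoc]
    _ < 1 * N := mul_lt_mul_of_pos_right hnum hN
    _ = N := one_mul N

theorem theorem4p2 :
    ∃ k₀ : ℕ, ∀ n k : ℕ, k₀ ≤ k →
      (2 + 3 / Real.log (k : ℝ)) * (k : ℝ) ^ 2 ≤ (n : ℝ) →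
      ∀ (G : SimpleGraph (Fin n)) [DecidableRel G.Adj],
        G.edgeFinset.card ≤ n * k →
        ∀ 𝓕 : Finset (Finset (Fin n)), 𝓕 ⊆ G.indepSetFinset k →
        ∀ (t : ℕ) (𝓖 : Finset (Finset (Fin n))),
          t ≤ k →
          (∀ B ∈ 𝓖, B.card = t) →
          ENNReal.ofReal (Real.sqrt (k : ℝ)) ≤ ((KneserFamily.coverNumber 𝓖 : ℕ∞) : ℝ≥0∞) →
          KneserFamily.CrossIntersecting 𝓕 𝓖 →
          n * 𝓕.card < (G.indepSetFinset k).card := by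
  -- This gives `log k / 20 ≥ 1000`, hence both `y ≥ 1000` and `log k ≤ y` for `y = k^(1/20)`.
  refine ⟨⌈Real.exp 20000⌉₊, ?_⟩
  intro n k hk hn G _ hE 𝓕 h𝓕 t 𝓖 ht hB hτ hcross
  have hke : Real.exp 20000 ≤ k := (Nat.le_ceil _).trans (by exact_mod_cast hk)
  have hk0 : (0 : ℝ) < k := (Real.exp_pos _).trans_le hke
  have hL : 20000 ≤ Real.log k := (Real.le_log_iff_exp_le hk0).2 hke
  have hk4 : 4 ≤ k := by
    have h1 := Real.add_one_le_exp (20000 : ℝ)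
    have : (4 : ℝ) ≤ k := by linarith
    exact_mod_cast this
  obtain ⟨y, hyL⟩ : ∃ y, y = Real.exp (Real.log k / 20) := ⟨_, rfl⟩
  have hy : 1000 ≤ y := by
    have := Real.add_one_le_exp (Real.log k / 20)
    linarith
  have hLy : Real.log k ≤ y := by
    have := Real.quadratic_le_exp_of_nonneg (x := Real.log k / 20) (by linarith)
    nlinarith
  have hky : (k : ℝ) = y ^ 20 := by
    rw [hyL, ← Real.exp_nat_mul, ← Real.exp_log hk0, Real.log_exp]
    congr 1
    push_cast
    ring
  have hsqrt : Real.sqrt k = y ^ 10 := by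
    rw [hky, show y ^ 20 = (y ^ 10) ^ 2 by ring, Real.sqrt_sq (by positivity)]
  have hfam : G.indepSetFinset k = indepFam G Finset.univ k := by
    ext A
    simp only [SimpleGraph.mem_indepSetFinset_iff, mem_indepFam, SimpleGraph.isNIndepSet_iff,
      Finset.subset_univ, true_and]
    tauto
  rw [hfam] at h𝓕 ⊢
  set s := ⌈y ^ 10⌉₊ with hs
  have hs1 : y ^ 10 ≤ s := Nat.le_ceil _
  have hs2 : (s : ℝ) ≤ y ^ 10 + 1 := (Nat.ceil_lt_add_one (by positivity)).le
  have hcov : ∀ X : Finset (Fin n), X.card < s →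
      ∃ B : Finset (Fin n), B.card ≤ k ∧ Disjoint X B ∧ ∀ F ∈ 𝓕, (F ∩ B).Nonempty := by
    intro X hX
    obtain ⟨B, hB1, hB2⟩ := exists_disjoint_of_le_coverNumber hτ (X := X) (by
      rw [hsqrt]
      exact Nat.lt_ceil.1 hX)
    exact ⟨B, (hB B hB1).trans_le ht, hB2, fun F hF => hcross F hF B hB1⟩
  have hE' : G.edgeFinset.card ≤ Fintype.card (Fin n) * k := by simpa using hE
  have hy1 : 1 ≤ y := by linarith
  have h2_10 : 1000 * y ≤ y ^ 10 := by
    have h1 : y ^ 2 ≤ y ^ 10 := pow_le_pow_right₀ hy1 (by norm_num)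
    nlinarith
  have hgoal : (Fintype.card (Fin n) : ℝ) * 𝓕.card < indepCount G Finset.univ k := by
    rcases le_or_gt ((n : ℕ) : ℝ) (8 * (k : ℝ) ^ 2) with h8 | h8
    · exact mul_card_lt_of_dense (s := s) (J := ⌈y ^ 15⌉₊) G hE' hk4 (by linarith) hyL hLy hy
        (by simpa using hn) (by simpa using h8) hs1 hs2 (Nat.le_ceil _)
        (Nat.ceil_lt_add_one (by positivity)).le h𝓕 hcov
    · refine mul_card_lt_of_large (s := s) G hE' (by omega) (by simpa using h8.le) ?_ ?_
        (by linarith) h𝓕 hcov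
      · have : (1 : ℝ) ≤ s := by linarith
        exact_mod_cast this
      · have h3 : y ^ 11 ≤ y ^ 20 := pow_le_pow_right₀ hy1 (by norm_num)
        have h4 : 1000 * y ^ 10 ≤ y ^ 11 := by
          rw [pow_succ y 10, mul_comm]
          gcongr
        have : (s : ℝ) ≤ k := by linarith
        exact_mod_cast this
  rw [Fintype.card_fin] at hgoal
  exact_mod_cast hgoal
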